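/- Let $\mathcal A=\bigoplus_{t\ge 0}\mathcal A_t$ be a graded (associative, unital) algebra over $\mathbb C$ with $\mathcal A_0=\mathbb C$ (that is, $c\mapsto c\cdot 1$ is a bijection of $\mathbb C$ onto $\mathcal A_0$), such that for all $s,t\in\{1,2,\dots\}$ the space $\mathcal A_t$ is two-dimensional and the multiplication map $\mathcal A_s\otimes\mathcal A_t\to\mathcal A_{s+t}$ is surjective. Then there exist an associative algebra $D$ over $\mathbb C$ (not necessarily with unit), two-dimensional as a linear space and with surjective multiplication map $D\otimes D\to D$, and an automorphism $\eta$ of $D$, such that $\mathcal A$ is isomorphic, as a graded algebra, to the following graded algebra $\mathcal B$: $\mathcal B_0=\mathbb C$, acting by scalars; $\mathcal B_t=D$ for $t=1,2,\dots$; and the product of $x\in\mathcal B_s$ and $y\in\mathcal B_t$ ($s,t\ge 1$) is $x\cdot\eta^s(y)\in\mathcal B_{s+t}$, computed in $D$. Here an isomorphism of graded algebras $\mathcal A\to\mathcal B$ is a family of linear bijections $\theta_t:\mathcal A_t\to\mathcal B_t$ ($t\ge 0$) with $\theta_0(1)=1$ and $\theta_{s+t}(xy)=\theta_s(x)\,\theta_t(y)$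 for all $x\in\mathcal A_s$, $y\in\mathcal A_t$, $s,t\ge 0$. -/

import Mathlib

open scoped TensorProduct

/-- The components of the graded algebra built from an algebra `D` (associative, not necessarily
with unit) and an endomorphism `η` of it: `ℂ` in degree `0` and `D` in every degree `t ≥ 1`.
The map `η` enters only through the multiplication. -/
def TwistedPower (D : Type) [NonUnitalRing D] [Module ℂ D] (_η : D →ₙₐ[ℂ] D) : ℕ → Type
  | 0 => ℂ
  | _ + 1 => D

namespace TwistedPower

variable {D : Type} [NonUnitalRing D] [Module ℂ D] (η : D →ₙₐ[ℂ] D)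

instance instAddCommGroup : ∀ t, AddCommGroup (TwistedPower D η t)
  | 0 => inferInstanceAs (AddCommGroup ℂ)
  | _ + 1 => inferInstanceAs (AddCommGroup D)

instance instModule : ∀ t, Module ℂ (TwistedPower D η t)
  | 0 => inferInstanceAs (Module ℂ ℂ)
  | _ + 1 => inferInstanceAs (Module ℂ D)

/-- The product `x * η^s (y)` in `D`. -/
def twistedMul (s : ℕ) (x y : D) : D := x * η^[s] y

/-- Multiplication of homogeneous elements: for `x` in degree `s ≥ 1` and `y` in degree `t ≥ 1`
it is `x * η^s (y)`, computed in `D`; elements of degree `0` act as scalars. -/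
def mul : ∀ {s t : ℕ}, TwistedPower D η s → TwistedPower D η t → TwistedPower D η (s + t)
  | 0, 0, c, d => (HMul.hMul : ℂ → ℂ → ℂ) c d
  | 0, _ + 1, c, y => (HSMul.hSMul : ℂ → D → D) c y
  | _ + 1, 0, x, d => (HSMul.hSMul : ℂ → D → D) d x
  | s + 1, _ + 1, x, y => twistedMul (D := D) η (s + 1) x y

theorem iterate_map_mul (s : ℕ) (x y : D) : η^[s] (x * y) = η^[s] x * η^[s] y := by
  induction s generalizing x y with
  | zero => rfl
  | succ n ih => simp only [Function.iterate_succ, Function.comp, map_mul, ih]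

theorem iterate_map_add (s : ℕ) (x y : D) : η^[s] (x + y) = η^[s] x + η^[s] y := by
  induction s generalizing x y with
  | zero => rfl
  | succ n ih => simp only [Function.iterate_succ, Function.comp, map_add, ih]

theorem iterate_map_zero (s : ℕ) : η^[s] 0 = 0 := by
  induction s with
  | zero => rfl
  | succ n ih => simp only [Function.iterate_succ, Function.comp, map_zero, ih]

theorem iterate_map_smul (s : ℕ) (c : ℂ) (x : D) : η^[s] (c • x) = c • η^[s] x := by
  induction s generalizing x with
  | zero => rfl
  | succ n ih => simp only [Function.iterate_succ, Function.comp, map_smul, ih]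

theorem mk_succ_eq {s t : ℕ} {x y : D} (hst : s = t) (hxy : x = y) :
    (GradedMonoid.mk (s + 1) x : GradedMonoid (TwistedPower D η)) = GradedMonoid.mk (t + 1) y := by
  subst hst hxy
  rfl

instance instGMul : GradedMonoid.GMul (TwistedPower D η) where
  mul := mul η

instance instGOne : GradedMonoid.GOne (TwistedPower D η) where
  one := (1 : ℂ)

theorem twistedMul_assoc (r s : ℕ) (x y z : D) :
    twistedMul η (r + s) (twistedMul η r x y) z = twistedMul η r x (twistedMul η s y z) := by
  simp only [twistedMul, iterate_map_mul, mul_assoc, Function.iterate_add_apply]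

theorem smul_twistedMul [IsScalarTower ℂ D D] (s : ℕ) (c : ℂ) (x y : D) :
    twistedMul η s (c • x) y = c • twistedMul η s x y :=
  smul_mul_assoc c x _

theorem twistedMul_smul [SMulCommClass ℂ D D] (s : ℕ) (c : ℂ) (x y : D) :
    twistedMul η s x (c • y) = c • twistedMul η s x y := by
  simp only [twistedMul, iterate_map_smul, mul_smul_comm]

theorem twistedMul_zero (s : ℕ) (x : D) : twistedMul η s x 0 = 0 := by
  simp only [twistedMul, iterate_map_zero, mul_zero]

theorem zero_twistedMul (s : ℕ) (x : D) : twistedMul η s 0 x = 0 :=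
  zero_mul _

theorem twistedMul_add (s : ℕ) (x y z : D) :
    twistedMul η s x (y + z) = twistedMul η s x y + twistedMul η s x z := by
  simp only [twistedMul, iterate_map_add, mul_add]

theorem add_twistedMul (s : ℕ) (x y z : D) :
    twistedMul η s (x + y) z = twistedMul η s x z + twistedMul η s y z :=
  add_mul x y _

variable [IsScalarTower ℂ D D] [SMulCommClass ℂ D D]

instance instGSemiring : DirectSum.GSemiring (TwistedPower D η) where
  mul_zero {i j} a := by
    cases i <;> cases j
    · exact mul_zero (M₀ := ℂ) a
    · exact smul_zero (A := D) (M := ℂ) a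
    · exact zero_smul ℂ (A := D) a
    · exact twistedMul_zero (D := D) η _ a
  zero_mul {i j} b := by
    cases i <;> cases j
    · exact zero_mul (M₀ := ℂ) b
    · exact zero_smul ℂ (A := D) b
    · exact smul_zero (A := D) (M := ℂ) b
    · exact zero_twistedMul (D := D) η _ b
  mul_add {i j} a b c := by
    cases i <;> cases j
    · exact mul_add (R := ℂ) a b c
    · exact smul_add (A := D) (M := ℂ) a b c
    · exact add_smul (R := ℂ) (M := D) b c a
    · exact twistedMul_add (D := D) η _ a b c
  add_mul {i j} a b c := by
    cases i <;> cases j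
    · exact add_mul (R := ℂ) a b c
    · exact add_smul (R := ℂ) (M := D) a b c
    · exact smul_add (A := D) (M := ℂ) c a b
    · exact add_twistedMul (D := D) η _ a b c
  one_mul := by
    rintro ⟨_ | i, a⟩
    · exact congrArg (GradedMonoid.mk 0) (one_mul (M := ℂ) a)
    · exact mk_succ_eq η (zero_add i) (one_smul ℂ (α := D) a)
  mul_one := by
    rintro ⟨_ | i, a⟩
    · exact congrArg (GradedMonoid.mk 0) (mul_one (M := ℂ) a)
    · exact mk_succ_eq η (add_zero i) (one_smul ℂ (α := D) a)
  mul_assoc := by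
    rintro ⟨_ | i, a⟩ ⟨_ | j, b⟩ ⟨_ | k, c⟩
    · exact congrArg (GradedMonoid.mk 0) (mul_assoc (G := ℂ) a b c)
    · exact mk_succ_eq η (s := 0 + 0 + k) (t := 0 + (0 + k)) (by omega)
        (mul_smul (α := ℂ) (β := D) a b c)
    · exact mk_succ_eq η (s := 0 + j + 0) (t := 0 + (j + 0)) (by omega)
        (smul_comm (M := ℂ) (N := ℂ) (α := D) c a b)
    · exact mk_succ_eq η (s := 0 + j + 1 + k) (t := 0 + (j + 1 + k)) (by omega)
        ((congrArg (fun n => twistedMul (D := D) η (n + 1) ((HSMul.hSMul : ℂ → D → D) a b) c)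
          (zero_add j)).trans (smul_twistedMul (D := D) η (j + 1) a b c))
    · exact mk_succ_eq η (s := i + 0 + 0) (t := i + (0 + 0)) (by omega)
        ((smul_smul (M := ℂ) (α := D) c b a).trans
          (congrArg (fun z : ℂ => (HSMul.hSMul : ℂ → D → D) z a) (mul_comm (G := ℂ) c b)))
    · exact mk_succ_eq η (s := i + 0 + 1 + k) (t := i + 1 + (0 + k)) (by omega)
        ((smul_twistedMul (D := D) η (i + 1) b a c).trans
          (twistedMul_smul (D := D) η (i + 1) b a c).symm)
    · exact mk_succ_eq η (s := i + 1 + j + 0) (t := i + 1 + (j + 0)) (by omega)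
        (twistedMul_smul (D := D) η (i + 1) c a b).symm
    · exact mk_succ_eq η (s := i + 1 + j + 1 + k) (t := i + 1 + (j + 1 + k)) (by omega)
        (twistedMul_assoc (D := D) η (i + 1) (j + 1) a b c)
  natCast n := (n : ℂ)
  natCast_zero := Nat.cast_zero (R := ℂ)
  natCast_succ n := Nat.cast_succ (R := ℂ) n

instance instGAlgebra : DirectSum.GAlgebra ℂ (TwistedPower D η) where
  toFun := AddMonoidHom.id ℂ
  map_one := rfl
  map_mul _ _ := rfl
  commutes := by
    rintro r ⟨_ | i, a⟩
    · exact congrArg (GradedMonoid.mk 0) (mul_comm (G := ℂ) r a)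
    · exact mk_succ_eq η (s := 0 + i) (t := i + 0) (by omega) rfl
  smul_def := by
    rintro r ⟨_ | i, a⟩
    · rfl
    · exact mk_succ_eq η (s := i) (t := 0 + i) (by omega) rfl

end TwistedPower

/-- The multiplication map `A s ⊗ A t → A (s + t)` of a graded algebra over `ℂ`. -/
noncomputable def gradedMulMap (A : ℕ → Type*) [∀ t, AddCommGroup (A t)] [∀ t, Module ℂ (A t)]
    [DirectSum.GSemiring A] [DirectSum.GAlgebra ℂ A] (s t : ℕ) : A s ⊗[ℂ] A t →ₗ[ℂ] A (s + t) :=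
  TensorProduct.lift (DirectSum.gMulLHom ℂ A)

/-- An isomorphism of graded algebras over `ℂ`: linear isomorphisms in each degree that preserve
the unit and the products of homogeneous elements. -/
structure GradedAlgIso (A B : ℕ → Type*)
    [∀ t, AddCommGroup (A t)] [∀ t, Module ℂ (A t)] [DirectSum.GSemiring A]
    [∀ t, AddCommGroup (B t)] [∀ t, Module ℂ (B t)] [DirectSum.GSemiring B] where
  toLinearEquiv : ∀ t, A t ≃ₗ[ℂ] B t
  map_one : toLinearEquiv 0 GradedMonoid.GOne.one = GradedMonoid.GOne.one
  map_mul : ∀ {s t : ℕ} (x : A s) (y : A t), toLinearEquiv (s + t) (GradedMonoid.GMul.mul x y) =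
    GradedMonoid.GMul.mul (toLinearEquiv s x) (toLinearEquiv t y)

/-! Let `u`, `v` span the degree-one component. In each degree the maps "left multiplication by `u +
c v`" form a pencil between planes, whose determinant is a quadratic polynomial in `c`. If it has
finitely many roots in every degree, only countably many `c` are bad, and some `a` of degree one is
left regular in all positive degrees. Otherwise the pencil is identically singular in some degree;
since its images span the target, it has a common kernel, so a nonzero homogeneous `k` is killed
from the left (`exists_regular_or_exists_killed`). The same dichotomy holds in the opposite algebra.
Elements killed from the left and from the right cannot coexist, since a product of two components
would be at most a line (`not_killed_left_and_right`). Hence, up to passing to the opposite algebra,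
a left regular `a` exists.

Then the degree `n + 1` component is `a ^ n V`, where `V` is the plane in degree one. Define `M` and
`σ` on `V` by `v w = a M(v, w)` and `v a = a σ(v)`. Then `a` is a left unit of `M`, and `M (M v w) u
= M (σ v) (M w u)`. If `σ` is invertible, untwisting by its powers gives an associative product with
`η = σ⁻¹`. If not, `M` itself is associative and `η = 1` works (`exists_isTwistedPower_of_regular`).
-/

/-! ### Linear algebra of planes and pencils. -/

/-- Two linearly independent vectors of a plane span it. -/
theorem exists_smul_add_smul_of_finrank_two {E : Type*} [AddCommGroup E] [Module ℂ E]
    (hE : Module.finrank ℂ E = 2) {v w : E}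
    (hvw : ∀ α β : ℂ, α • v + β • w = 0 → α = 0 ∧ β = 0) (x : E) :
    ∃ α β : ℂ, α • v + β • w = x := by
  have : FiniteDimensional ℂ E := Module.finite_of_finrank_pos (by omega)
  have hli : LinearIndependent ℂ ![v, w] := LinearIndependent.pair_iff.2 hvw
  have hspan := hli.span_eq_top_of_card_eq_finrank' (by simp [hE])
  have hx : x ∈ Submodule.span ℂ (Set.range ![v, w]) := hspan ▸ Submodule.mem_top
  rw [Matrix.range_cons_cons_empty] at hx
  exact Submodule.mem_span_pair.1 hx

/-- A vector killed by a linear map and a vector not killed by it span a plane. -/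
theorem exists_smul_add_smul_of_map {E F : Type*} [AddCommGroup E] [Module ℂ E]
    [AddCommGroup F] [Module ℂ F] (hE : Module.finrank ℂ E = 2) (f : E →ₗ[ℂ] F) {v w : E}
    (hv : f v ≠ 0) (hw : f w = 0) (hw0 : w ≠ 0) (x : E) :
    ∃ α β : ℂ, α • v + β • w = x := by
  refine exists_smul_add_smul_of_finrank_two hE (fun α β h => ?_) x
  have h1 := congrArg f h
  simp only [map_add, map_smul, hw, smul_zero, add_zero, map_zero, smul_eq_zero, hv,
    or_false] at h1
  subst h1
  simpa [hw0] using h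

theorem exists_ne_smul_add_smul {E : Type*} [AddCommGroup E] [Module ℂ E]
    (hE : Module.finrank ℂ E = 2) {k : E} (hk : k ≠ 0) :
    ∃ l : E, ∀ x : E, ∃ α β : ℂ, α • k + β • l = x := by
  obtain ⟨l, hl⟩ : ∃ l : E, l ∉ Submodule.span ℂ {k} := by
    by_contra! h
    have h1 : Submodule.span ℂ {k} = ⊤ := eq_top_iff.2 fun x _ => h x
    have h2 := finrank_span_singleton (K := ℂ) hk
    rw [h1, finrank_top, hE] at h2
    omega
  refine ⟨l, exists_smul_add_smul_of_finrank_two hE fun α β h => ?_⟩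
  have hβ : β = 0 := by
    by_contra hβ
    refine hl (Submodule.mem_span_singleton.2 ⟨-(β⁻¹ * α), ?_⟩)
    have h1 : β • l = -(α • k) := by rw [eq_neg_iff_add_eq_zero, add_comm]; exact h
    calc -(β⁻¹ * α) • k = β⁻¹ • -(α • k) := by rw [smul_neg, smul_smul, neg_smul]
      _ = l := by rw [← h1, smul_smul, inv_mul_cancel₀ hβ, one_smul]
  subst hβ
  simpa [hk] using h

/-- If infinitely many members `f + c g` of a pencil of maps between planes are singular, then all
members are. -/
theorem pencil_not_injective {F G : Type*} [AddCommGroup F] [Module ℂ F]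
    [AddCommGroup G] [Module ℂ G] (hF : Module.finrank ℂ F = 2) (hG : Module.finrank ℂ G = 2)
    (f g : F →ₗ[ℂ] G) (hfg : {c : ℂ | ¬ Function.Injective (f + c • g)}.Infinite) (x y : ℂ) :
    ¬ Function.Injective (x • f + y • g) := by
  have : FiniteDimensional ℂ F := Module.finite_of_finrank_pos (by omega)
  have : FiniteDimensional ℂ G := Module.finite_of_finrank_pos (by omega)
  let bF := Module.finBasisOfFinrankEq ℂ F hF
  let bG := Module.finBasisOfFinrankEq ℂ G hG
  let q : (F →ₗ[ℂ] G) → ℂ := fun h => (LinearMap.toMatrix bF bG h).det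
  have hq : ∀ h : F →ₗ[ℂ] G, q h = 0 ↔ ¬ Function.Injective h := by
    intro h
    rw [← not_iff_not, not_not]
    constructor
    · intro h0
      have : IsUnit (LinearMap.toMatrix bF bG h).det := isUnit_iff_ne_zero.2 h0
      exact (LinearEquiv.ofIsUnitDet this).injective
    · intro hi
      let e := LinearEquiv.ofInjectiveOfFinrankEq h hi (hF.trans hG.symm)
      exact isUnit_iff_ne_zero.1 (LinearEquiv.isUnit_det e bF bG)
  -- The determinant of a 2 × 2 pencil is a binary quadratic form; `β` is its polarization.
  -- Infinitely many zeros at the points `(1, c)` kill all three coefficients.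
  obtain ⟨β, hβ⟩ : ∃ β, ∀ x y : ℂ, q (x • f + y • g) = x ^ 2 * q f + x * y * β + y ^ 2 * q g := by
    let M := LinearMap.toMatrix bF bG f
    let N := LinearMap.toMatrix bF bG g
    refine ⟨M 0 0 * N 1 1 + N 0 0 * M 1 1 - M 0 1 * N 1 0 - N 0 1 * M 1 0, fun x y => ?_⟩
    simp only [q, M, N, map_add, map_smul, Matrix.det_fin_two, Matrix.add_apply,
      Matrix.smul_apply, smul_eq_mul]
    ring
  let p : Polynomial ℂ := Polynomial.C (q g) * Polynomial.X ^ 2 + Polynomial.C β * Polynomial.X +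
    Polynomial.C (q f)
  have hp : p = 0 := by
    refine Polynomial.eq_zero_of_infinite_isRoot p (hfg.mono fun c hc => ?_)
    have h1 := (hq _).2 hc
    have h2 := hβ 1 c
    rw [one_smul, h1] at h2
    simp only [Set.mem_ofPred_eq, Polynomial.IsRoot, p, Polynomial.eval_add, Polynomial.eval_mul,
      Polynomial.eval_C, Polynomial.eval_pow, Polynomial.eval_X]
    linear_combination -h2
  have h0 : q f = 0 := by simpa [p] using congrArg (fun r => Polynomial.coeff r 0) hp
  have h1 : β = 0 := by
    simpa [p, Polynomial.coeff_X, Polynomial.coeff_C] using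
      congrArg (fun r => Polynomial.coeff r 1) hp
  have h2 : q g = 0 := by
    simpa [p, Polynomial.coeff_X, Polynomial.coeff_C] using
      congrArg (fun r => Polynomial.coeff r 2) hp
  rw [← hq, hβ, h0, h1, h2]
  ring

/-- A pencil of singular maps between planes whose images span the target has a common kernel. -/
theorem exists_common_kernel {F G : Type*} [AddCommGroup F] [Module ℂ F]
    [AddCommGroup G] [Module ℂ G] (hF : Module.finrank ℂ F = 2) (hG : Module.finrank ℂ G = 2)
    (f g : F →ₗ[ℂ] G) (hfg : {c : ℂ | ¬ Function.Injective (f + c • g)}.Infinite)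
    (hspan : LinearMap.range f ⊔ LinearMap.range g = ⊤) :
    ∃ k : F, k ≠ 0 ∧ f k = 0 ∧ g k = 0 := by
  have hsing : ∀ x y : ℂ, ∃ k : F, k ≠ 0 ∧ x • f k + y • g k = 0 := by
    intro x y
    have h := pencil_not_injective hF hG f g hfg x y
    rw [injective_iff_map_eq_zero] at h
    push Not at h
    obtain ⟨k, hk, hk0⟩ := h
    exact ⟨k, hk0, by simpa using hk⟩
  by_cases hf : ∀ w, f w = 0
  · obtain ⟨k, hk0, hk⟩ := hsing 0 1
    exact ⟨k, hk0, hf k, by simpa using hk⟩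
  push Not at hf
  obtain ⟨v, hv⟩ := hf
  obtain ⟨w, hw0, hw⟩ := hsing 1 0
  have hfw : f w = 0 := by simpa using hw
  by_cases hgw : g w = 0
  · exact ⟨w, hw0, hfw, hgw⟩
  exfalso
  let Z := Submodule.span ℂ {g w}
  have hz : g w ∈ Z := Submodule.mem_span_singleton_self _
  -- A kernel vector `α v + β w` of `f + y g` has `α ≠ 0`, because `g w ≠ 0`; this puts `f v + y g
  -- v` on the line `Z`. The values `y = 1` and `y = -1` then put both images inside `Z`,
  -- contradicting `hspan`.
  have key : ∀ y : ℂ, y ≠ 0 → f v + y • g v ∈ Z := by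
    intro y hy
    obtain ⟨k, hk0, hk⟩ := hsing 1 y
    obtain ⟨α, β, rfl⟩ := exists_smul_add_smul_of_map hF f hv hfw hw0 k
    simp only [map_add, map_smul, hfw, smul_zero, add_zero, one_smul, smul_add] at hk
    have hα : α ≠ 0 := by
      rintro rfl
      simp [hy, hgw] at hk
      simp [hk] at hk0
    have h1 : α • (f v + y • g v) ∈ Z := by
      have : α • (f v + y • g v) = -((y * β) • g w) := by
        rw [eq_neg_iff_add_eq_zero, ← hk]
        module
      rw [this]
      exact Z.neg_mem (Z.smul_mem _ hz)
    exact (Submodule.smul_mem_iff _ hα).1 h1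
  have h1 := key 1 one_ne_zero
  have h2 := key (-1) (by norm_num)
  have hfv : f v ∈ Z := by
    have : f v = (2⁻¹ : ℂ) • ((f v + (1 : ℂ) • g v) + (f v + (-1 : ℂ) • g v)) := by module
    rw [this]
    exact Z.smul_mem _ (Z.add_mem h1 h2)
  have hgv : g v ∈ Z := by
    have : g v = (f v + (1 : ℂ) • g v) - f v := by module
    rw [this]
    exact Z.sub_mem h1 hfv
  have hZ : Z = ⊤ := by
    rw [eq_top_iff, ← hspan, sup_le_iff]
    constructor <;> rintro _ ⟨k, rfl⟩ <;>
      obtain ⟨α, β, rfl⟩ := exists_smul_add_smul_of_map hF f hv hfw hw0 k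
    · simpa [hfw] using Z.smul_mem α hfv
    · simpa using Z.add_mem (Z.smul_mem α hgv) (Z.smul_mem β hz)
  have h3 := finrank_span_singleton (K := ℂ) hgw
  change Module.finrank ℂ Z = 1 at h3
  rw [hZ, finrank_top, hG] at h3
  omega

/-! ### Regular elements and killed elements in a plane grading. -/

/-- The homogeneous components, in positive degrees, of a graded algebra generated in degree one
whose components of positive degree are planes. -/
structure IsPlaneGrading {R : Type*} [Ring R] [Algebra ℂ R] (S : ℕ → Submodule ℂ R) : Prop where
  finrank_eq : ∀ t, 1 ≤ t → Module.finrank ℂ (S t) = 2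
  mul_eq : ∀ s t, 1 ≤ s → 1 ≤ t → S s * S t = S (s + t)

namespace IsPlaneGrading

variable {R : Type*} [Ring R] [Algebra ℂ R] {S : ℕ → Submodule ℂ R}

theorem mul_mem (hS : IsPlaneGrading S) {s t : ℕ} (hs : 1 ≤ s) (ht : 1 ≤ t) {x y : R}
    (hx : x ∈ S s) (hy : y ∈ S t) : x * y ∈ S (s + t) :=
  hS.mul_eq s t hs ht ▸ Submodule.mul_mem_mul hx hy

theorem finiteDimensional (hS : IsPlaneGrading S) {t : ℕ} (ht : 1 ≤ t) :
    FiniteDimensional ℂ (S t) :=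
  Module.finite_of_finrank_pos (by rw [hS.finrank_eq t ht]; omega)

/-- The opposite grading. -/
theorem op (hS : IsPlaneGrading S) :
    IsPlaneGrading fun t => (S t).map (MulOpposite.opLinearEquiv ℂ : R ≃ₗ[ℂ] Rᵐᵒᵖ).toLinearMap where
  finrank_eq t ht := by
    rw [← hS.finrank_eq t ht]
    exact LinearEquiv.finrank_map_eq (MulOpposite.opLinearEquiv ℂ : R ≃ₗ[ℂ] Rᵐᵒᵖ) (S t)
  mul_eq s t hs ht := by
    rw [add_comm, ← hS.mul_eq t s ht hs]
    exact (Submodule.map_op_mul _ _).symm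

/-- Left multiplication by an element of degree one, as a map between components. -/
def mulLeft (hS : IsPlaneGrading S) {u : R} (hu : u ∈ S 1) {t : ℕ} (ht : 1 ≤ t) :
    S t →ₗ[ℂ] S (1 + t) :=
  (LinearMap.mulLeft ℂ u).restrict fun _ hx => hS.mul_mem le_rfl ht hu hx

@[simp] theorem coe_mulLeft (hS : IsPlaneGrading S) {u : R} (hu : u ∈ S 1) {t : ℕ} (ht : 1 ≤ t)
    (x : S t) : (hS.mulLeft hu ht x : R) = u * x := rfl

theorem exists_generators (hS : IsPlaneGrading S) :
    ∃ u ∈ S 1, ∃ v ∈ S 1, ∀ x ∈ S 1, ∃ α β : ℂ, α • u + β • v = x := by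
  have h2 := hS.finrank_eq 1 le_rfl
  have : Nontrivial (S 1) := Module.nontrivial_of_finrank_pos (R := ℂ) (by omega)
  obtain ⟨u, hu⟩ := exists_ne (0 : S 1)
  obtain ⟨v, hv⟩ := exists_ne_smul_add_smul h2 hu
  refine ⟨u, u.2, v, v.2, fun x hx => ?_⟩
  obtain ⟨α, β, h⟩ := hv ⟨x, hx⟩
  exact ⟨α, β, congrArg Subtype.val h⟩

theorem range_sup_range (hS : IsPlaneGrading S) {u v : R} (hu : u ∈ S 1) (hv : v ∈ S 1)
    (huv : ∀ x ∈ S 1, ∃ α β : ℂ, α • u + β • v = x) {t : ℕ} (ht : 1 ≤ t) :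
    LinearMap.range (hS.mulLeft hu ht) ⊔ LinearMap.range (hS.mulLeft hv ht) = ⊤ := by
  rw [eq_top_iff]
  rintro ⟨z, hz⟩ -
  have hz' := hz
  rw [← hS.mul_eq 1 t le_rfl ht] at hz'
  suffices h : z ∈ (LinearMap.range (hS.mulLeft hu ht) ⊔ LinearMap.range (hS.mulLeft hv ht)).map
      (S (1 + t)).subtype by
    obtain ⟨z', hz1, rfl⟩ := h
    exact hz1
  refine Submodule.mul_induction_on hz' ?_ fun _ _ => Submodule.add_mem _
  intro x hx y hy
  obtain ⟨α, β, rfl⟩ := huv x hx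
  refine ⟨hS.mulLeft hu ht (α • ⟨y, hy⟩) + hS.mulLeft hv ht (β • ⟨y, hy⟩),
    Submodule.add_mem_sup ⟨_, rfl⟩ ⟨_, rfl⟩, ?_⟩
  simp [add_mul]

/-- Either some element of degree one is left regular, or some nonzero homogeneous element is
killed by left multiplication by all elements of degree one. -/
theorem exists_regular_or_exists_killed (hS : IsPlaneGrading S) :
    (∃ a ∈ S 1, ∀ t, 1 ≤ t → ∀ x ∈ S t, a * x = 0 → x = 0) ∨
      ∃ t, 1 ≤ t ∧ ∃ k ∈ S t, k ≠ 0 ∧ ∀ x ∈ S 1, x * k = 0 := by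
  obtain ⟨u, hu, v, hv, huv⟩ := hS.exists_generators
  -- `bad n` concerns degree `n + 1`, so that only positive degrees occur.
  let bad : ℕ → Set ℂ := fun n =>
    {c | ¬ Function.Injective (hS.mulLeft hu n.succ_pos + c • hS.mulLeft hv n.succ_pos)}
  by_cases hbad : ∀ n, (bad n).Finite
  · left
    have hc : (⋃ n, bad n).Countable := Set.countable_iUnion fun n => (hbad n).countable
    obtain ⟨c, hc⟩ : ∃ c, c ∉ ⋃ n, bad n := by
      by_contra! h
      exact not_countable_complex (hc.mono fun c _ => h c)
    refine ⟨u + c • v, (S 1).add_mem hu ((S 1).smul_mem c hv), ?_⟩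
    rintro (_ | n) ht x hx h0
    · omega
    have hinj : Function.Injective
        (hS.mulLeft hu n.succ_pos + c • hS.mulLeft hv n.succ_pos) := by
      by_contra h
      exact hc (Set.mem_iUnion.2 ⟨n, h⟩)
    have h1 := (injective_iff_map_eq_zero _).1 hinj ⟨x, hx⟩
      (Subtype.ext (by simpa [add_mul] using h0))
    exact congrArg Subtype.val h1
  · right
    push Not at hbad
    obtain ⟨n, hn⟩ := hbad
    obtain ⟨k, hk0, hku, hkv⟩ := exists_common_kernel (hS.finrank_eq _ n.succ_pos)
      (hS.finrank_eq _ (by omega)) (hS.mulLeft hu n.succ_pos) (hS.mulLeft hv n.succ_pos) hn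
      (hS.range_sup_range hu hv huv _)
    refine ⟨n + 1, n.succ_pos, k, k.2, by simpa using hk0, fun x hx => ?_⟩
    have h1 : u * k = 0 := congrArg Subtype.val hku
    have h2 : v * k = 0 := congrArg Subtype.val hkv
    obtain ⟨α, β, rfl⟩ := huv x hx
    simp [add_mul, h1, h2]

/-- Every component of degree at least two is spanned by products whose last factor has degree one,
and that factor already kills `k`. -/
theorem mul_eq_zero_of_killed_left (hS : IsPlaneGrading S) {k : R} (hk : ∀ x ∈ S 1, x * k = 0)
    {s : ℕ} (hs : 1 ≤ s) {x : R} (hx : x ∈ S s) : x * k = 0 := by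
  obtain rfl | hs := hs.eq_or_lt
  · exact hk x hx
  obtain ⟨n, rfl⟩ : ∃ n, s = n + 1 := ⟨s - 1, by omega⟩
  rw [← hS.mul_eq n 1 (by omega) le_rfl] at hx
  refine Submodule.mul_induction_on hx (fun y _ z hz => ?_) fun y z hy hz => ?_
  · rw [mul_assoc, hk z hz, mul_zero]
  · rw [add_mul, hy, hz, add_zero]

theorem mul_eq_zero_of_killed_right (hS : IsPlaneGrading S) {k : R} (hk : ∀ x ∈ S 1, k * x = 0)
    {s : ℕ} (hs : 1 ≤ s) {x : R} (hx : x ∈ S s) : k * x = 0 := by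
  obtain rfl | hs := hs.eq_or_lt
  · exact hk x hx
  obtain ⟨n, rfl⟩ : ∃ n, s = 1 + n := ⟨s - 1, by omega⟩
  rw [← hS.mul_eq 1 n le_rfl (by omega)] at hx
  refine Submodule.mul_induction_on hx (fun y hy z _ => ?_) fun y z hy hz => ?_
  · rw [← mul_assoc, hk y hy, zero_mul]
  · rw [mul_add, hy, hz, add_zero]

/-- Complete `k` and `k'` to bases by `l` and `l'`. Of the four products of basis vectors only `l' *
l` can survive, so `S s * S t` has dimension at most one instead of two. -/
theorem not_killed_left_and_right (hS : IsPlaneGrading S) {s t : ℕ} (hs : 1 ≤ s) (ht : 1 ≤ t)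
    {k k' : R} (hkt : k ∈ S t) (hk0 : k ≠ 0) (hk : ∀ x ∈ S 1, x * k = 0)
    (hks' : k' ∈ S s) (hk0' : k' ≠ 0) (hk' : ∀ x ∈ S 1, k' * x = 0) : False := by
  obtain ⟨l, hl⟩ := exists_ne_smul_add_smul (hS.finrank_eq t ht) (k := ⟨k, hkt⟩)
    (by simpa using hk0)
  obtain ⟨l', hl'⟩ := exists_ne_smul_add_smul (hS.finrank_eq s hs) (k := ⟨k', hks'⟩)
    (by simpa using hk0')
  have h1 : S (s + t) ≤ Submodule.span ℂ {(l' : R) * l} := by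
    rw [← hS.mul_eq s t hs ht, Submodule.mul_le]
    intro x hx y hy
    obtain ⟨α, β, hαβ⟩ := hl ⟨y, hy⟩
    obtain ⟨α', β', hαβ'⟩ := hl' ⟨x, hx⟩
    obtain rfl : α • k + β • (l : R) = y := congrArg Subtype.val hαβ
    obtain rfl : α' • k' + β' • (l' : R) = x := congrArg Subtype.val hαβ'
    have e1 := hS.mul_eq_zero_of_killed_right hk' ht hkt
    have e2 := hS.mul_eq_zero_of_killed_right hk' ht l.2
    have e3 := hS.mul_eq_zero_of_killed_left hk hs l'.2
    refine Submodule.mem_span_singleton.2 ⟨β' * β, ?_⟩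
    simp [add_mul, mul_add, e1, e2, e3, smul_smul, mul_comm]
  have h2 := Submodule.finrank_mono h1
  have h3 := finrank_span_le_card (R := ℂ) ({(l' : R) * l} : Set R)
  rw [hS.finrank_eq _ (by omega)] at h2
  simp at h3
  omega

end IsPlaneGrading

/-! ### Twisted powers and passage to the opposite algebra. -/

/-- The components `S t`, `t ≥ 1`, are identified with one plane `V` carrying an associative
multiplication `μ` in such a way that the product is `μ x (η ^ s y)` for an automorphism `η`. -/
structure IsTwistedPower {R V : Type*} [Ring R] [Algebra ℂ R] [AddCommGroup V] [Module ℂ V]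
    (S : ℕ → Submodule ℂ R) (μ : V →ₗ[ℂ] V →ₗ[ℂ] V) (η : V ≃ₗ[ℂ] V) (ψ : ℕ → V →ₗ[ℂ] R) :
    Prop where
  assoc : ∀ x y z, μ (μ x y) z = μ x (μ y z)
  map_mul : ∀ x y, η (μ x y) = μ (η x) (η y)
  exists_mul : ∀ z, ∃ x y, μ x y = z
  injective : ∀ t, 1 ≤ t → Function.Injective (ψ t)
  range_eq : ∀ t, 1 ≤ t → LinearMap.range (ψ t) = S t
  mul_eq : ∀ s t, 1 ≤ s → 1 ≤ t → ∀ x y, ψ (s + t) (μ x ((η ^ s) y)) = ψ s x * ψ t y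

namespace IsTwistedPower

variable {R V : Type*} [Ring R] [Algebra ℂ R] [AddCommGroup V] [Module ℂ V]
  {S : ℕ → Submodule ℂ R}

theorem zpow_map_mul {μ : V →ₗ[ℂ] V →ₗ[ℂ] V} {η : V ≃ₗ[ℂ] V}
    (h : ∀ x y, η (μ x y) = μ (η x) (η y)) (n : ℤ) (x y : V) :
    (η ^ n) (μ x y) = μ ((η ^ n) x) ((η ^ n) y) := by
  have h' : ∀ x y, η⁻¹ (μ x y) = μ (η⁻¹ x) (η⁻¹ y) := fun x y => by
    apply η.injective
    rw [h]
    simp only [← LinearEquiv.mul_apply, mul_inv_cancel, LinearEquiv.coe_one, id]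
  induction n generalizing x y with
  | zero => rfl
  | succ n ih => simp only [zpow_add_one, LinearEquiv.mul_apply, h, ih]
  | pred n ih => simp only [zpow_sub_one, LinearEquiv.mul_apply, h', ih]

/-- A twisted power structure on the opposite algebra gives one on the algebra. -/
theorem unop {μ : V →ₗ[ℂ] V →ₗ[ℂ] V} {η : V ≃ₗ[ℂ] V} {ψ : ℕ → V →ₗ[ℂ] Rᵐᵒᵖ}
    (h : IsTwistedPower
      (fun t => (S t).map (MulOpposite.opLinearEquiv ℂ : R ≃ₗ[ℂ] Rᵐᵒᵖ).toLinearMap) μ η ψ) :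
    IsTwistedPower S μ.flip η⁻¹ fun t =>
      (MulOpposite.opLinearEquiv ℂ : R ≃ₗ[ℂ] Rᵐᵒᵖ).symm.toLinearMap ∘ₗ ψ t ∘ₗ
        (η ^ t : V ≃ₗ[ℂ] V).toLinearMap where
  assoc x y z := (h.assoc z y x).symm
  map_mul x y := by simpa using zpow_map_mul h.map_mul (-1) y x
  exists_mul z := by
    obtain ⟨x, y, rfl⟩ := h.exists_mul z
    exact ⟨y, x, rfl⟩
  injective t ht := by
    exact MulOpposite.unop_injective.comp ((h.injective t ht).comp (η ^ t).injective)
  range_eq t ht := by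
    rw [LinearMap.range_comp, LinearEquiv.range_comp, h.range_eq t ht]
    ext x
    simp
  -- Reversing the factors puts the twist `η ^ t` on `x`. Precomposing `ψ t` with `η ^ t` in each
  -- degree `t` moves it to `y`, as `η⁻¹ ^ s`.
  mul_eq s t hs ht x y := by
    have h1 := h.mul_eq t s ht hs ((η ^ t) y) ((η ^ s) x)
    have h2 : (η ^ (s + t)) (μ.flip x ((η⁻¹ ^ s) y)) = μ ((η ^ t) y) ((η ^ t) ((η ^ s) x)) := by
      have := zpow_map_mul h.map_mul ((s + t : ℕ) : ℤ) ((η⁻¹ ^ s) y) x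
      rw [zpow_natCast] at this
      rw [LinearMap.flip_apply, this]
      simp only [← LinearEquiv.mul_apply]
      congr 3
      · group
      · group
    apply MulOpposite.op_injective
    simp only [LinearMap.comp_apply, LinearEquiv.coe_coe, h2]
    rw [add_comm s t, h1]
    rfl

end IsTwistedPower

/-! ### Structure in the presence of a left regular element. -/

namespace IsPlaneGrading

variable {R V : Type*} [Ring R] [Algebra ℂ R] [AddCommGroup V] [Module ℂ V]
  {S : ℕ → Submodule ℂ R}

/-- Multiplication by `a` is injective from one plane to the next, hence onto by dimension. -/
theorem injective_and_range_pow_mul (hS : IsPlaneGrading S) {a : R} (ha : a ∈ S 1)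
    (hreg : ∀ t, 1 ≤ t → ∀ x ∈ S t, a * x = 0 → x = 0) {ι : V →ₗ[ℂ] R}
    (hι : Function.Injective ι) (hιr : LinearMap.range ι = S 1)
    (hV : Module.finrank ℂ V = 2) (n : ℕ) :
    Function.Injective (LinearMap.mulLeft ℂ (a ^ n) ∘ₗ ι) ∧
      LinearMap.range (LinearMap.mulLeft ℂ (a ^ n) ∘ₗ ι) = S (n + 1) := by
  induction n with
  | zero => simpa using ⟨hι, hιr⟩
  | succ n ih =>
    have hmem : ∀ v, a ^ n * ι v ∈ S (n + 1) := fun v => ih.2 ▸ ⟨v, rfl⟩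
    have hinj : Function.Injective (LinearMap.mulLeft ℂ (a ^ (n + 1)) ∘ₗ ι) := by
      refine (injective_iff_map_eq_zero _).2 fun v hv => ?_
      refine (injective_iff_map_eq_zero _).1 ih.1 v (hreg (n + 1) (by omega) _ (hmem v) ?_)
      simpa [pow_succ', mul_assoc] using hv
    refine ⟨hinj, ?_⟩
    have := hS.finiteDimensional (t := n + 1 + 1) (by omega)
    refine Submodule.eq_of_le_of_finrank_eq ?_ ?_
    · rintro _ ⟨v, rfl⟩
      have h1 := hS.mul_mem le_rfl (by omega) ha (hmem v)
      rw [← mul_assoc, ← pow_succ', add_comm] at h1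
      exact h1
    · rw [LinearMap.finrank_range_of_inj hinj, hV, hS.finrank_eq _ (by omega)]

theorem exists_isTwistedPower_of_regular (hS : IsPlaneGrading S)
    (hV : Module.finrank ℂ V = 2) {a : R} (ha : a ∈ S 1)
    (hreg : ∀ t, 1 ≤ t → ∀ x ∈ S t, a * x = 0 → x = 0) :
    ∃ (μ : V →ₗ[ℂ] V →ₗ[ℂ] V) (η : V ≃ₗ[ℂ] V) (ψ : ℕ → V →ₗ[ℂ] R), IsTwistedPower S μ η ψ := by
  have : FiniteDimensional ℂ V := Module.finite_of_finrank_pos (by omega)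
  have := hS.finiteDimensional le_rfl
  let e : V ≃ₗ[ℂ] S 1 := LinearEquiv.ofFinrankEq _ _ (hV.trans (hS.finrank_eq 1 le_rfl).symm)
  let ι : V →ₗ[ℂ] R := (S 1).subtype ∘ₗ e.toLinearMap
  have hι : Function.Injective ι := (S 1).subtype_injective.comp e.injective
  have hιr : LinearMap.range ι = S 1 := by
    rw [LinearMap.range_comp, LinearEquiv.range, Submodule.map_top, Submodule.range_subtype]
  have hιmem : ∀ v, ι v ∈ S 1 := fun v => (e v).2
  have hpow := hS.injective_and_range_pow_mul ha hreg hι hιr hV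
  have hinj : ∀ n v w, a ^ n * ι v = a ^ n * ι w → v = w := fun n v w h => (hpow n).1 h
  obtain ⟨a', rfl⟩ : ∃ a', ι a' = a := by rwa [← hιr] at ha
  -- Products of degree-one elements lie in `S 2 = a S 1`; the quotient by `a` is the multiplication
  -- `M`.
  have hex : ∀ v w, ∃ z, ι a' * ι z = ι v * ι w := by
    intro v w
    have h1 := hS.mul_mem le_rfl le_rfl (hιmem v) (hιmem w)
    rw [← (hpow 1).2] at h1
    obtain ⟨z, hz⟩ := h1
    exact ⟨z, by simpa using hz⟩
  choose m hm using hex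
  have hinj1 : ∀ v w, ι a' * ι v = ι a' * ι w → v = w := by simpa using hinj 1
  let M : V →ₗ[ℂ] V →ₗ[ℂ] V := LinearMap.mk₂ ℂ m
    (fun x y z => hinj1 _ _ (by simp only [map_add, mul_add, add_mul, hm]))
    (fun c x y => hinj1 _ _ (by simp only [map_smul, smul_mul_assoc, mul_smul_comm, hm]))
    (fun x y z => hinj1 _ _ (by simp only [map_add, mul_add, hm]))
    (fun c x y => hinj1 _ _ (by simp only [map_smul, mul_smul_comm, hm]))
  have hM : ∀ v w, ι a' * ι (M v w) = ι v * ι w := hm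
  have hunit : ∀ w, M a' w = w := fun w => hinj1 _ _ (hM _ _)
  let σ : V →ₗ[ℂ] V := M.flip a'
  have hσ : ∀ v, ι a' * ι (σ v) = ι v * ι a' := fun v => hM v a'
  have hσa : σ a' = a' := hunit a'
  have ha0 : a' ≠ 0 := by
    rintro rfl
    have : Nontrivial V := Module.nontrivial_of_finrank_pos (R := ℂ) (by omega)
    obtain ⟨v, hv⟩ := exists_ne (0 : V)
    exact hv (by simpa using (hunit v).symm)
  -- Multiplied by `a ^ 2`, both sides become the product `v w u`.
  have hassoc : ∀ v w u, M (M v w) u = M (σ v) (M w u) := by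
    intro v w u
    apply hinj 2
    rw [pow_two, mul_assoc, mul_assoc, hM, hM, ← mul_assoc, ← mul_assoc, hM, hσ, mul_assoc,
      mul_assoc, hM]
  have hσM : ∀ v w, σ (M v w) = M (σ v) (σ w) := fun v w => hassoc v w a'
  have hcomm : ∀ n v, ι v * ι a' ^ n = ι a' ^ n * ι ((σ ^ n) v) := by
    intro n
    induction n with
    | zero => simp
    | succ n ih =>
      intro v
      rw [pow_succ, ← mul_assoc, ih, mul_assoc, ← hσ, pow_succ', ← mul_assoc, Module.End.mul_apply]
  have hprod : ∀ i j v w, (ι a' ^ i * ι v) * (ι a' ^ j * ι w) =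
      ι a' ^ (i + 1 + j) * ι (M ((σ ^ j) v) w) := by
    intro i j v w
    rw [mul_assoc, ← mul_assoc (ι v), hcomm, mul_assoc, ← hM]
    simp only [← mul_assoc, ← pow_add, ← pow_succ]
    congr 2
    omega
  by_cases hσi : Function.Injective σ
  · let τ : V ≃ₗ[ℂ] V := LinearEquiv.ofInjectiveEndo σ hσi
    have hτ : ∀ v, τ v = σ v := fun v => rfl
    have hτn : ∀ (n : ℕ) v, (τ ^ n) v = (σ ^ n) v := by
      intro n
      induction n with
      | zero => simp
      | succ n ih =>
        intro v
        rw [pow_succ, pow_succ, LinearEquiv.mul_apply, Module.End.mul_apply, ih, hτ]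
    have hτM := IsTwistedPower.zpow_map_mul (η := τ) (μ := M) hσM
    have hτs : ∀ v, τ (τ⁻¹ v) = v := τ.apply_symm_apply
    -- The product is `μ x y = M (τ⁻¹ x) y`, with `ψ t x = a ^ (t - 1) τ ^ t x`. By `hprod`, `ψ s x
    -- * ψ t y` equals `a ^ (s + t - 1)` times `M (τ ^ (s + t - 1) x) (τ ^ t y)`, which is `τ ^ (s +
    -- t)` applied to `μ x (τ⁻¹ ^ s y)`.
    refine ⟨M ∘ₗ (τ⁻¹ : V ≃ₗ[ℂ] V).toLinearMap, τ⁻¹, fun t =>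
      (LinearMap.mulLeft ℂ (ι a' ^ (t - 1)) ∘ₗ ι) ∘ₗ (τ ^ t : V ≃ₗ[ℂ] V).toLinearMap, ?_⟩
    constructor
    · intro x y z
      have h1 : ∀ x y, τ⁻¹ (M x y) = M (τ⁻¹ x) (τ⁻¹ y) := by simpa using hτM (-1)
      simp only [LinearMap.comp_apply, LinearEquiv.coe_coe, h1]
      rw [hassoc, ← hτ, hτs]
    · intro x y
      simpa using hτM (-1) (τ⁻¹ x) y
    · intro z
      refine ⟨τ a', z, ?_⟩
      simp [hunit]
    · intro t _
      exact (hpow (t - 1)).1.comp (τ ^ t).injective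
    · intro t ht
      rw [LinearEquiv.range_comp, (hpow (t - 1)).2, Nat.sub_add_cancel ht]
    · intro s t hs ht x y
      obtain ⟨i, rfl⟩ : ∃ i, s = i + 1 := ⟨s - 1, by omega⟩
      obtain ⟨j, rfl⟩ : ∃ j, t = j + 1 := ⟨t - 1, by omega⟩
      simp only [LinearMap.comp_apply, LinearMap.mulLeft_apply, LinearEquiv.coe_coe,
        Nat.add_sub_cancel]
      rw [hprod, ← hτn, show i + 1 + (j + 1) - 1 = i + 1 + j by omega]
      have h1 := hτM ((i + 1 + (j + 1) : ℕ) : ℤ)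
      simp only [zpow_natCast] at h1
      rw [h1]
      simp only [← LinearEquiv.mul_apply]
      have e1 : τ ^ (i + 1 + (j + 1)) * τ⁻¹ = τ ^ j * τ ^ (i + 1) := by group
      have e2 : τ ^ (i + 1 + (j + 1)) * τ⁻¹ ^ (i + 1) = τ ^ (j + 1) := by group
      rw [e1, e2]
  · rw [injective_iff_map_eq_zero] at hσi
    push Not at hσi
    obtain ⟨b, hσb, hb0⟩ := hσi
    have hspan := exists_smul_add_smul_of_map hV σ (hσa.symm ▸ ha0) hσb hb0
    -- By `hassoc`, `M b w` annihilates everything from the left. In particular `σ` kills it, so it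
    -- is a multiple of `b`; were it nonzero, `b` itself would annihilate everything, and `M b w`
    -- would vanish.
    have hbM : ∀ w, M b w = 0 := by
      intro w
      by_contra hw
      have hz : ∀ u, M (M b w) u = 0 := fun u => by rw [hassoc, hσb, map_zero, LinearMap.zero_apply]
      obtain ⟨α, β, hαβ⟩ := hspan (M b w)
      have hα : α = 0 := by
        have h1 : σ (M b w) = 0 := hz a'
        rw [← hαβ] at h1
        simpa [hσa, hσb, ha0] using h1
      subst hα
      have hβ : β ≠ 0 := by
        rintro rfl
        simp at hαβ
        exact hw hαβ.symm
      have h2 := hz w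
      rw [← hαβ] at h2
      simp [hβ] at h2
      exact hw h2
    -- `σ` fixes `a'` and kills `b`, so `v` and `σ v` differ by a multiple of `b`, invisible to `M`
    -- on the left. This turns twisted associativity into associativity.
    have hMσ : ∀ v w, M (σ v) w = M v w := by
      intro v w
      obtain ⟨α, β, rfl⟩ := hspan v
      simp [hσa, hσb, hbM]
    have hMσn : ∀ (n : ℕ) v w, M ((σ ^ n) v) w = M v w := by
      intro n
      induction n with
      | zero => simp
      | succ n ih =>
        intro v w
        rw [pow_succ, Module.End.mul_apply, ih, hMσ]
    refine ⟨M, 1, fun t => LinearMap.mulLeft ℂ (ι a' ^ (t - 1)) ∘ₗ ι, ?_⟩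
    constructor
    · intro x y z
      rw [hassoc, hMσ]
    · intro x y
      rfl
    · exact fun z => ⟨a', z, hunit z⟩
    · exact fun t _ => (hpow (t - 1)).1
    · intro t ht
      rw [(hpow (t - 1)).2, Nat.sub_add_cancel ht]
    · intro s t hs ht x y
      obtain ⟨i, rfl⟩ : ∃ i, s = i + 1 := ⟨s - 1, by omega⟩
      obtain ⟨j, rfl⟩ : ∃ j, t = j + 1 := ⟨t - 1, by omega⟩
      simp only [LinearMap.comp_apply, LinearMap.mulLeft_apply, Nat.add_sub_cancel, one_pow]
      rw [hprod, hMσn, show i + 1 + (j + 1) - 1 = i + 1 + j by omega]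
      rfl

theorem exists_isTwistedPower (hS : IsPlaneGrading S) (hV : Module.finrank ℂ V = 2) :
    ∃ (μ : V →ₗ[ℂ] V →ₗ[ℂ] V) (η : V ≃ₗ[ℂ] V) (ψ : ℕ → V →ₗ[ℂ] R), IsTwistedPower S μ η ψ := by
  obtain ⟨a, ha, hreg⟩ | ⟨t, ht, k, hkt, hk0, hk⟩ := hS.exists_regular_or_exists_killed
  · exact hS.exists_isTwistedPower_of_regular hV ha hreg
  obtain ⟨a, ha, hreg⟩ | ⟨s, hs, _, ⟨k', hks', rfl⟩, hk0', hk'⟩ :=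
    hS.op.exists_regular_or_exists_killed
  · obtain ⟨μ, η, ψ, h⟩ := hS.op.exists_isTwistedPower_of_regular hV ha hreg
    exact ⟨_, _, _, h.unop⟩
  · exact (hS.not_killed_left_and_right hs ht hkt hk0 hk hks' (by simpa using hk0')
      fun x hx => MulOpposite.op_injective (hk' _ ⟨x, hx, rfl⟩)).elim

end IsPlaneGrading

/-! ### Transfer between graded algebras and submodules of the direct sum. -/

/-- The non-unital ring with a given associative bilinear multiplication. -/
abbrev nonUnitalRingOfBilin {V : Type*} [AddCommGroup V] [Module ℂ V] (μ : V →ₗ[ℂ] V →ₗ[ℂ] V)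
    (h : ∀ x y z, μ (μ x y) z = μ x (μ y z)) : NonUnitalRing V where
  __ := (inferInstance : AddCommGroup V)
  mul x y := μ x y
  left_distrib x y z := (μ x).map_add y z
  right_distrib x y z := μ.map_add₂ x y z
  zero_mul x := μ.map_zero₂ x
  mul_zero x := (μ x).map_zero
  mul_assoc := h

section GradedAlgebra

variable {A : ℕ → Type*} [∀ t, AddCommGroup (A t)] [∀ t, Module ℂ (A t)]
  [DirectSum.GSemiring A] [DirectSum.GAlgebra ℂ A]

theorem lof_gradedMulMap_mem_mul (s t : ℕ) (z : A s ⊗[ℂ] A t) :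
    DirectSum.lof ℂ ℕ A (s + t) (gradedMulMap A s t z) ∈
      LinearMap.range (DirectSum.lof ℂ ℕ A s) * LinearMap.range (DirectSum.lof ℂ ℕ A t) := by
  induction z with
  | zero => simp
  | add x y hx hy =>
    rw [map_add, map_add]
    exact Submodule.add_mem _ hx hy
  | tmul x y =>
    have : DirectSum.lof ℂ ℕ A (s + t) (gradedMulMap A s t (x ⊗ₜ y)) =
        DirectSum.lof ℂ ℕ A s x * DirectSum.lof ℂ ℕ A t y :=
      (DirectSum.of_mul_of x y).symm
    rw [this]
    exact Submodule.mul_mem_mul ⟨x, rfl⟩ ⟨y, rfl⟩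

theorem range_lof_mul_range_lof {s t : ℕ} (h : Function.Surjective (gradedMulMap A s t)) :
    LinearMap.range (DirectSum.lof ℂ ℕ A s) * LinearMap.range (DirectSum.lof ℂ ℕ A t) =
      LinearMap.range (DirectSum.lof ℂ ℕ A (s + t)) := by
  refine le_antisymm (Submodule.mul_le.2 ?_) ?_
  · rintro _ ⟨x, rfl⟩ _ ⟨y, rfl⟩
    exact ⟨GradedMonoid.GMul.mul x y, (DirectSum.of_mul_of x y).symm⟩
  · rintro _ ⟨x, rfl⟩
    obtain ⟨z, rfl⟩ := h x
    exact lof_gradedMulMap_mem_mul s t z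

theorem of_toFun_mul (c : ℂ) (y : DirectSum ℕ A) :
    DirectSum.of A 0 (DirectSum.GAlgebra.toFun c) * y = c • y := by
  rw [Algebra.smul_def]
  rfl

theorem mul_of_toFun (c : ℂ) (y : DirectSum ℕ A) :
    y * DirectSum.of A 0 (DirectSum.GAlgebra.toFun c) = c • y := by
  rw [Algebra.smul_def, Algebra.commutes]
  rfl

theorem of_gMul_toFun_left (c : ℂ) {t : ℕ} (y : A t) :
    DirectSum.of A (0 + t) (GradedMonoid.GMul.mul (DirectSum.GAlgebra.toFun c : A 0) y) =
      c • DirectSum.of A t y := by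
  rw [← DirectSum.of_mul_of, of_toFun_mul]

theorem of_gMul_toFun_right (c : ℂ) {t : ℕ} (y : A t) :
    DirectSum.of A (t + 0) (GradedMonoid.GMul.mul y (DirectSum.GAlgebra.toFun c : A 0)) =
      c • DirectSum.of A t y := by
  rw [← DirectSum.of_mul_of, mul_of_toFun]

theorem toFun_smul (c d : ℂ) :
    (DirectSum.GAlgebra.toFun (c • d) : A 0) = c • DirectSum.GAlgebra.toFun d := by
  apply DirectSum.of_injective (β := A) 0
  have h1 : DirectSum.of A 0 (c • DirectSum.GAlgebra.toFun d) =
      c • DirectSum.of A 0 (DirectSum.GAlgebra.toFun d) :=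
    (DirectSum.lof ℂ ℕ A 0).map_smul c _
  rw [h1, ← mul_one (DirectSum.of A 0 _), of_toFun_mul, ← mul_one (DirectSum.of A 0 _),
    of_toFun_mul, smul_smul, smul_eq_mul]

/-- The scalars as the component of degree zero. -/
noncomputable def zeroEquiv (h : Function.Bijective (DirectSum.GAlgebra.toFun : ℂ →+ A 0)) :
    ℂ ≃ₗ[ℂ] A 0 :=
  LinearEquiv.ofBijective { (DirectSum.GAlgebra.toFun : ℂ →+ A 0) with map_smul' := toFun_smul } h

end GradedAlgebra

/-- Linear bijections in each degree, compatible with products of elements of positive degree and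
of the form `c ↦ c • 1` in degree zero, form an isomorphism onto the twisted power. -/
theorem nonempty_gradedAlgIso {A : ℕ → Type*} [∀ t, AddCommGroup (A t)] [∀ t, Module ℂ (A t)]
    [DirectSum.GSemiring A] [DirectSum.GAlgebra ℂ A]
    (hA₀ : Function.Bijective (DirectSum.GAlgebra.toFun : ℂ →+ A 0))
    {D : Type} [NonUnitalRing D] [Module ℂ D] [IsScalarTower ℂ D D] [SMulCommClass ℂ D D]
    (η : D →ₙₐ[ℂ] D) (ψ : ℕ → D →ₗ[ℂ] DirectSum ℕ A)
    (hinj : ∀ t, 1 ≤ t → Function.Injective (ψ t))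
    (hrange : ∀ t, 1 ≤ t → LinearMap.range (ψ t) = LinearMap.range (DirectSum.lof ℂ ℕ A t))
    (hmul : ∀ s t, 1 ≤ s → 1 ≤ t → ∀ x y, ψ (s + t) (x * η^[s] y) = ψ s x * ψ t y) :
    Nonempty (GradedAlgIso A (TwistedPower D η)) := by
  have hex : ∀ t : ℕ, ∃ e : A (t + 1) ≃ₗ[ℂ] D,
      ∀ x, ψ (t + 1) (e x) = DirectSum.of A (t + 1) x := by
    intro t
    refine ⟨LinearEquiv.ofInjective (DirectSum.lof ℂ ℕ A (t + 1)) (DirectSum.of_injective _) ≪≫ₗ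
      LinearEquiv.ofEq _ _ (hrange _ t.succ_pos).symm ≪≫ₗ
      (LinearEquiv.ofInjective (ψ (t + 1)) (hinj _ t.succ_pos)).symm, fun x => ?_⟩
    have h1 := fun z => congrArg Subtype.val
      ((LinearEquiv.ofInjective (ψ (t + 1)) (hinj _ t.succ_pos)).apply_symm_apply z)
    exact h1 _
  choose e he using hex
  let θ : ∀ t, A t ≃ₗ[ℂ] TwistedPower D η t := fun t => match t with
    | 0 => (zeroEquiv hA₀).symm
    | t + 1 => e t
  have hθ₀ : ∀ c, θ 0 (zeroEquiv hA₀ c) = c := (zeroEquiv hA₀).symm_apply_apply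
  refine ⟨θ, ?_, ?_⟩
  · have h1 : zeroEquiv hA₀ 1 = GradedMonoid.GOne.one :=
      DirectSum.GAlgebra.map_one (R := ℂ) (A := A)
    rw [← h1]
    exact hθ₀ 1
  · intro s t x y
    rcases s with _ | s <;> rcases t with _ | t
    · obtain ⟨c, rfl⟩ := (zeroEquiv hA₀).surjective x
      obtain ⟨d, rfl⟩ := (zeroEquiv hA₀).surjective y
      have h1 : GradedMonoid.GMul.mul (zeroEquiv hA₀ c) (zeroEquiv hA₀ d) =
          zeroEquiv hA₀ (c * d) := by
        apply DirectSum.of_injective (β := A) 0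
        refine (of_gMul_toFun_left c (zeroEquiv hA₀ d)).trans ?_
        rw [← smul_eq_mul c d, map_smul]
        exact ((DirectSum.lof ℂ ℕ A 0).map_smul c _).symm
      rw [h1]
      exact (hθ₀ (c * d)).trans
        (congrArg₂ (fun a b : ℂ => a * b) (hθ₀ c) (hθ₀ d)).symm
    · obtain ⟨c, rfl⟩ := (zeroEquiv hA₀).surjective x
      rw [hθ₀]
      -- `0 + (t + 1)` unfolds to `(0 + t) + 1`, so `θ` is `e (0 + t)` here. Comparing images under
      -- `ψ` in the direct sum avoids transport between degrees.
      apply hinj (0 + t + 1) (by omega)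
      refine (he (0 + t) _).trans ?_
      refine Eq.trans ?_ ((ψ (0 + t + 1)).map_smul c (e t y)).symm
      have h1 : ψ (0 + t + 1) (e t y) = DirectSum.of A (t + 1) y := by rw [zero_add, he]
      rw [h1]
      exact of_gMul_toFun_left c y
    · obtain ⟨c, rfl⟩ := (zeroEquiv hA₀).surjective y
      rw [hθ₀]
      apply hinj (s + 1) (by omega)
      refine (he s _).trans ?_
      refine Eq.trans ?_ ((ψ (s + 1)).map_smul c (e s x)).symm
      rw [he]
      exact of_gMul_toFun_right c x
    · apply hinj (s + 1 + (t + 1)) (by omega)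
      refine (he (s + 1 + t) _).trans ?_
      refine Eq.trans ?_ (hmul (s + 1) (t + 1) (by omega) (by omega) (e s x) (e t y)).symm
      rw [he, he, DirectSum.of_mul_of]
      rfl

theorem theorem1 (A : ℕ → Type*) [∀ t, AddCommGroup (A t)] [∀ t, Module ℂ (A t)]
    [DirectSum.GSemiring A] [DirectSum.GAlgebra ℂ A]
    (hA₀ : Function.Bijective (DirectSum.GAlgebra.toFun : ℂ →+ A 0))
    (hdim : ∀ t, 1 ≤ t → Module.finrank ℂ (A t) = 2)
    (hmul : ∀ s t, 1 ≤ s → 1 ≤ t → Function.Surjective (gradedMulMap A s t)) :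
    ∃ (D : Type) (_ : NonUnitalRing D) (_ : Module ℂ D) (_ : IsScalarTower ℂ D D)
      (_ : SMulCommClass ℂ D D) (η : D →ₙₐ[ℂ] D),
      Module.finrank ℂ D = 2 ∧
      Function.Surjective (LinearMap.mul' ℂ D) ∧
      Function.Bijective η ∧
      Nonempty (GradedAlgIso A (TwistedPower D η)) := by
  -- Negation on the direct sum comes from the scalar `-1`.
  let : Ring (DirectSum ℕ A) := Algebra.semiringToRing ℂ
  have hS : IsPlaneGrading fun t => LinearMap.range (DirectSum.lof ℂ ℕ A t) :=
    { finrank_eq := fun t ht => by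
        rw [← hdim t ht]
        exact LinearMap.finrank_range_of_inj (DirectSum.of_injective t)
      mul_eq := fun s t hs ht => range_lof_mul_range_lof (hmul s t hs ht) }
  -- `D` has to lie in `Type` whatever the universe of `A`, so a fixed plane serves as a model for
  -- all components.
  obtain ⟨μ, η, ψ, h⟩ := hS.exists_isTwistedPower (V := EuclideanSpace ℂ (Fin 2)) (by simp)
  let : NonUnitalRing (EuclideanSpace ℂ (Fin 2)) := nonUnitalRingOfBilin μ h.assoc
  have h1 : IsScalarTower ℂ (EuclideanSpace ℂ (Fin 2)) (EuclideanSpace ℂ (Fin 2)) :=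
    ⟨fun c x y => μ.map_smul₂ c x y⟩
  have h2 : SMulCommClass ℂ (EuclideanSpace ℂ (Fin 2)) (EuclideanSpace ℂ (Fin 2)) :=
    ⟨fun c x y => ((μ x).map_smul c y).symm⟩
  let η' : EuclideanSpace ℂ (Fin 2) →ₙₐ[ℂ] EuclideanSpace ℂ (Fin 2) :=
    { toFun := η
      map_smul' := η.map_smul
      map_zero' := η.map_zero
      map_add' := η.map_add
      map_mul' := h.map_mul }
  refine ⟨EuclideanSpace ℂ (Fin 2), inferInstance, inferInstance, h1, h2, η',
    finrank_euclideanSpace_fin, ?_, η.bijective, ?_⟩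
  · intro z
    obtain ⟨x, y, rfl⟩ := h.exists_mul z
    exact ⟨x ⊗ₜ y, rfl⟩
  · refine nonempty_gradedAlgIso hA₀ η' ψ h.injective h.range_eq fun s t hs ht x y => ?_
    rw [← h.mul_eq s t hs ht]
    have : ∀ n : ℕ, η'^[n] y = (η ^ n) y := by
      intro n
      induction n with
      | zero => rfl
      | succ n ih => rw [Function.iterate_succ_apply', ih, pow_succ', LinearEquiv.mul_apply]; rfl
    rw [this]
    rfl
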